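/- **Games.** A stochastic 2-player game $\mathcal G=((V_1,V_2,V_p),E,\delta,s_0)$ consists of pairwise disjoint sets of nodes with union $V$, a set $E\subseteq (V_1\cup V_2)\times V$ of moves (written $q\to r$), a map $\delta$ from $V_p$ to the finitely supported probability distributions on $V$, and $s_0\in V_1$. A run is a nonempty finite word over $V$ that starts with $s_0$ and in which each node $q$ is followed by some $r$ with $q\to r$ (if $q\in V_1\cup V_2$) or with $\delta(q)(r)>0$ (if $q\in V_p$). A strategy of Player $i$ is a partial function $\phi$ from runs to finitely supported distributions on $V$, defined exactly on the runs that end in a node of $V_i$ having a successor, such that $wx$ is a run whenever $\phi(w)(x)>0$. The value of a run under $\phi_1,\phi_2$ is the product of the probabilities of its steps (given by $\phi_1$, $\phi_2$ or $\delta$ according to the owner of the current node). For $F\subseteq V_1$, $\mathrm{Reach}(\mathcal G[\phi_1,\phi_2],F)$ is the sum of the values of all runs whose last node, and no earlier node, lies in $F$. For $\kappa\in\{++,+-,-+,--\}$, $\mathrm{Reach}(\mathcal G,F)^{\kappa}$ is obtained by taking $\sup$ ($+$) or $\inf$ ($-$) over $\phi_1$ outermost (first sign), and $\sup$ or $\inf$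 over $\phi_2$ (second sign). For an MDP ($V_2=\emptyset$) Player 2 has only the empty strategy, and $\mathrm{Reach}^{+}$, $\mathrm{Reach}^-$ denote the $\sup$ and $\inf$ over $\phi_1$. **Programs.** Let $\mathcal V$ be a finite set of variables with ranges, and $\Sigma$ the set of configurations (maps assigning to each variable an element of its range). A transition is a map $f:2^\Sigma\to 2^\Sigma$ with $|f(\{\sigma\})|\le 1$ and $f(M)=\bigcup_{\sigma\in M}f(\{\sigma\})$; it is a guard if always $f(\{\sigma\})\in\{\{\sigma\},\emptyset\}$ ($\sigma$ enables $f$ if $f(\{\sigma\})=\{\sigma\}$), and an assignment if always $|f(\{\sigma\})|=1$, in which case $f(\{\sigma\})=\{[\![f]\!](\sigma)\}$. A nondeterministic probabilistic program $P$ consists of $\mathcal V$, an initial configuration $\sigma_0$ and a finite set $\mathcal C$ of guarded commands $A=(g_A\to p_1:c_1+\dots+p_m:c_m)$, $m\ge1$, with a guard $g_A$, probabilities $p_j$ summing to $1$, and assignments $c_j$. Its MDP $\mathcal M_P$ has $V_1=\Sigma$, $V_p=\Sigma\times\mathcal C$, start $\sigma_0$, moves $\sigma\to\langle\sigma,A\rangle$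 iff $\sigma$ enables $g_A$, and $\delta(\langle\sigma,A\rangle)(\sigma')=\sum_{j:\,[\![c_j]\!](\sigma)=\sigma'}p_j$. Let $F\subseteq\Sigma$ with $\sigma_0\notin F$, and assume that every run of $\mathcal M_P$ ending in a configuration ends in an element of $F$ or in a configuration enabling some guard. **Valid abstractions.** Let $D^\sharp$ be a complete lattice with maps $\alpha:2^\Sigma\to D^\sharp$, $\gamma:D^\sharp\to 2^\Sigma$ forming a Galois connection. A game $\mathcal G$ with finitely many nodes is a valid abstraction of $P$ relative to $F$ for $D^\sharp$ if: - $V_1$ consists of some elements of $D^\sharp$ and two further states $\varocircle,\varotimes$, which have no outgoing moves; $s_0=\alpha(\{\sigma_0\})$. Below, $s$ ranges over $V_1\setminus\{\varocircle,\varotimes\}$. - The elements of $V_2$ are pairs $\langle s,\varocircle\rangle$, or $\langle s,A\rangle$ with $A\in\mathcal C$ enabled by some state of $\gamma(s)$. - The elements of $V_p$ are tuples $\langle s,A,s',d\rangle$ where $s'\in D^\sharp$, $s'\sqsubseteq s$, $A\in\mathcal C$ is enabled by some state of $\gamma(s')$, and $d$ assigns to every update $\langle p_j,c_j\rangle$ of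 $A$ an abstract state $d_j\in V_1\cap D^\sharp$ with $c_j(\gamma(s'))\subseteq\gamma(d_j)$; moreover $\delta(\langle s,A,s',d\rangle)(s'')=\sum_{j:\,d_j=s''}p_j$. - The moves of Player 1 are exactly: $s\to\langle s,\varocircle\rangle$ if $\gamma(s)\cap F\neq\emptyset$; and $s\to\langle s,A\rangle$ if $g_A(\gamma(s))\ne\emptyset$ and $\gamma(s)\not\subseteq F$. - If $\gamma(s)\cap F\ne\emptyset$, then $\langle s,\varocircle\rangle\to\varocircle$; if in addition $\gamma(s)\subseteq F$, this is the only move from $\langle s,\varocircle\rangle$, and otherwise also $\langle s,\varocircle\rangle\to\langle s,\varocircle\rangle$. - For every $\langle s,A\rangle\in V_2$ with $A\in\mathcal C$: the sets $\gamma(s')$ of the successors $\langle s,A,s',d\rangle$ of $\langle s,A\rangle$ cover $g_A(\gamma(s))$; if $\gamma(s)\cap F\neq\emptyset$ then $\langle s,A\rangle\to\varocircle$; if $g_A(\gamma(s))\ne\gamma(s)$ then $\langle s,A\rangle\to\varotimes$. No disjointness of the sets $\gamma(s)$ is required. **Theorem.** If $\mathcal G$ is a valid abstraction of $P$ relative to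 $F$ for $D^\sharp$, then $$\mathrm{Reach}(\mathcal M_P,F)^{-}\in\big[\mathrm{Reach}(\mathcal G,\{\varocircle,\varotimes\})^{--},\ \mathrm{Reach}(\mathcal G,\{\varocircle,\varotimes\})^{-+}\big]$$ and $$\mathrm{Reach}(\mathcal M_P,F)^{+}\in\big[\mathrm{Reach}(\mathcal G,\{\varocircle\})^{+-},\ \mathrm{Reach}(\mathcal G,\{\varocircle\})^{++}\big].$$ -/

import Mathlib

open scoped ENNReal

universe u v w x

/-! ## Stochastic two-player games -/

/-- A stochastic 2-player game whose nodes are drawn from the type `N`. `V1`, `V2`, `Vp` are the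
nodes of Player 1, of Player 2 and the probabilistic nodes, `E` is the set of admissible player
choices and `s0` the start state. The distribution `δ v` has finite support; only its values at
nodes `v ∈ Vp` matter. -/
structure StochasticGame (N : Type u) where
  V1 : Set N
  V2 : Set N
  Vp : Set N
  disjoint12 : Disjoint V1 V2
  disjoint1p : Disjoint V1 Vp
  disjoint2p : Disjoint V2 Vp
  E : N → N → Prop
  E_source : ∀ {q r}, E q r → q ∈ V1 ∪ V2
  E_target : ∀ {q r}, E q r → r ∈ V1 ∪ V2 ∪ Vp
  δ : N → PMF N
  δ_target : ∀ q ∈ Vp, (δ q).support ⊆ V1 ∪ V2 ∪ Vp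
  δ_finite : ∀ q ∈ Vp, (δ q).support.Finite
  s0 : N
  s0_mem : s0 ∈ V1

namespace StochasticGame

variable {N : Type u}

/-- The set `V` of all nodes. -/
def V (G : StochasticGame N) : Set N := G.V1 ∪ G.V2 ∪ G.Vp

/-- Finite runs. A run `x₁ x₂ … xₖ` is represented by the list `[xₖ, …, x₂, x₁]`, that is, the
most recent node comes first. -/
inductive IsRun (G : StochasticGame N) : List N → Prop
  | start : IsRun G [G.s0]
  | player {w : List N} {s' s : N} :
      IsRun G (s' :: w) → s' ∈ G.V1 ∪ G.V2 → G.E s' s → IsRun G (s :: s' :: w)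
  | random {w : List N} {s' s : N} :
      IsRun G (s' :: w) → s' ∈ G.Vp → 0 < G.δ s' s → IsRun G (s :: s' :: w)

/-- A run is accepting relative to `F` if its last node is in `F` and no earlier node is. -/
def IsAccepting (G : StochasticGame N) (F : Set N) (w : List N) : Prop :=
  G.IsRun w ∧ ∃ (y : N) (w' : List N), w = y :: w' ∧ y ∈ F ∧ ∀ z ∈ w', z ∉ F

/-- Strategies of the player who owns the set `U` of nodes (`U = V1` or `U = V2`): partial
functions from runs to distributions of finite support, defined exactly on the runs that end in a
node of `U` that has a successor, and choosing only moves that prolong the run to a run. -/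
structure Strategy (G : StochasticGame N) (U : Set N) where
  choice : List N → Option (PMF N)
  defined_iff : ∀ w, (choice w).isSome ↔
    G.IsRun w ∧ ∃ (y : N) (w' : List N), w = y :: w' ∧ y ∈ U ∧ ∃ z, G.E y z
  finite_support : ∀ w μ, choice w = some μ → μ.support.Finite
  admissible : ∀ w μ, choice w = some μ → ∀ z, 0 < μ z → G.IsRun (z :: w)

/-- The probability `φ(w)(z)`, taken to be `0` if `φ(w)` is undefined. -/
noncomputable def Strategy.prob {G : StochasticGame N} {U : Set N} (φ : G.Strategy U)
    (w : List N) (z : N) : ℝ≥0∞ :=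
  match φ.choice w with
  | some μ => μ z
  | none => 0

open Classical in
/-- The value of a run under a pair of strategies. -/
noncomputable def val (G : StochasticGame N) (φ₁ : G.Strategy G.V1) (φ₂ : G.Strategy G.V2) :
    List N → ℝ≥0∞
  | [] => 0
  | [s] => if s = G.s0 then 1 else 0
  | s :: s' :: w =>
      val G φ₁ φ₂ (s' :: w) *
        (if s' ∈ G.V1 then φ₁.prob (s' :: w) s
         else if s' ∈ G.V2 then φ₂.prob (s' :: w) s
         else if s' ∈ G.Vp then G.δ s' s
         else 0)

/-- The probability of reaching `F` under a pair of strategies. -/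
noncomputable def reach (G : StochasticGame N) (φ₁ : G.Strategy G.V1) (φ₂ : G.Strategy G.V2)
    (F : Set N) : ℝ≥0∞ :=
  ∑' r : {r : List N // G.IsAccepting F r}, G.val φ₁ φ₂ r.1

/-- The extremal game value `++`. -/
noncomputable def reachPP (G : StochasticGame N) (F : Set N) : ℝ≥0∞ :=
  ⨆ φ₁ : G.Strategy G.V1, ⨆ φ₂ : G.Strategy G.V2, G.reach φ₁ φ₂ F

/-- The extremal game value `+-`. -/
noncomputable def reachPM (G : StochasticGame N) (F : Set N) : ℝ≥0∞ :=
  ⨆ φ₁ : G.Strategy G.V1, ⨅ φ₂ : G.Strategy G.V2, G.reach φ₁ φ₂ F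

/-- The extremal game value `-+`. -/
noncomputable def reachMP (G : StochasticGame N) (F : Set N) : ℝ≥0∞ :=
  ⨅ φ₁ : G.Strategy G.V1, ⨆ φ₂ : G.Strategy G.V2, G.reach φ₁ φ₂ F

/-- The extremal game value `--`. -/
noncomputable def reachMM (G : StochasticGame N) (F : Set N) : ℝ≥0∞ :=
  ⨅ φ₁ : G.Strategy G.V1, ⨅ φ₂ : G.Strategy G.V2, G.reach φ₁ φ₂ F

end StochasticGame

/-! ## Nondeterministic probabilistic programs -/

/-- Configurations: maps that assign to every variable a value in its range. -/
abbrev Config {𝒱 : Type u} (rng : 𝒱 → Type v) : Type (max u v) := (y : 𝒱) → rng y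

/-- A transition maps singletons to singletons or the empty set, and is determined by its values
on singletons. -/
structure Transition (S : Type u) where
  toFun : Set S → Set S
  subsingleton : ∀ σ, (toFun {σ}).Subsingleton
  iUnion_eq : ∀ M, ⋃ σ ∈ M, toFun {σ} = toFun M

namespace Transition

variable {S : Type u}

instance : CoeFun (Transition S) (fun _ => Set S → Set S) := ⟨Transition.toFun⟩

def IsGuard (g : Transition S) : Prop := ∀ σ, g {σ} = {σ} ∨ g {σ} = ∅

/-- The configuration `σ` enables the guard `g`. -/
def Enables (σ : S) (g : Transition S) : Prop := g {σ} = {σ}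

def IsAssignment (c : Transition S) : Prop := ∀ σ, ∃ σ', c {σ} = {σ'}

/-- The semantics `⟦c⟧ : S → S` of an assignment. -/
noncomputable def IsAssignment.sem {c : Transition S} (hc : c.IsAssignment) (σ : S) : S :=
  (hc σ).choose

theorem IsAssignment.sem_spec {c : Transition S} (hc : c.IsAssignment) (σ : S) :
    c {σ} = {hc.sem σ} :=
  (hc σ).choose_spec

end Transition

/-- A guarded command `g → p₁ : c₁ + … + pₘ : cₘ`. The probabilities `p₁, …, pₘ`, which add up
to `1`, form a probability mass function on `Fin m` (so that `m ≥ 1`). -/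
structure GuardedCommand (S : Type u) where
  guard : Transition S
  isGuard : guard.IsGuard
  m : ℕ
  p : PMF (Fin m)
  c : Fin m → Transition S
  isAssignment : ∀ j, (c j).IsAssignment

/-- A nondeterministic probabilistic program over the variables `𝒱` with ranges `rng`, whose
guarded commands are named by the elements of `ι`. -/
structure NPP {𝒱 : Type u} (rng : 𝒱 → Type v) (ι : Type w) where
  σ0 : Config rng
  cmd : ι → GuardedCommand (Config rng)

namespace NPP

variable {𝒱 : Type u} {rng : 𝒱 → Type v} {ι : Type w}

/-- The Markov decision process of a program, as a game without nodes of Player 2: `Sum.inl σ` is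
the Player 1 node `σ` and `Sum.inr (σ, A)` is the probabilistic node `⟨σ, A⟩`. -/
noncomputable def mdp (P : NPP rng ι) : StochasticGame (Config rng ⊕ Config rng × ι) where
  V1 := Set.range Sum.inl
  V2 := ∅
  Vp := Set.range Sum.inr
  disjoint12 := Set.disjoint_empty _
  disjoint1p := by
    rw [Set.disjoint_left]
    rintro _ ⟨a, rfl⟩ ⟨b, hb⟩
    cases hb
  disjoint2p := Set.empty_disjoint _
  E := fun q r => ∃ (σ : Config rng) (A : ι),
    q = Sum.inl σ ∧ r = Sum.inr (σ, A) ∧ Transition.Enables σ (P.cmd A).guard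
  E_source := by
    rintro _ _ ⟨σ, A, rfl, rfl, _⟩
    simp
  E_target := by
    rintro _ _ ⟨σ, A, rfl, rfl, _⟩
    simp
  δ := fun q =>
    match q with
    | Sum.inl σ => PMF.pure (Sum.inl σ)
    | Sum.inr (σ, A) =>
        (P.cmd A).p.map (fun j => Sum.inl (((P.cmd A).isAssignment j).sem σ))
  δ_target := by
    rintro _ ⟨⟨σ, A⟩, rfl⟩ y hy
    rw [PMF.support_map] at hy
    obtain ⟨j, -, rfl⟩ := hy
    simp
  δ_finite := by
    rintro _ ⟨⟨σ, A⟩, rfl⟩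
    rw [PMF.support_map]
    exact (Set.toFinite _).image _
  s0 := Sum.inl P.σ0
  s0_mem := ⟨P.σ0, rfl⟩

/-- The maximal probability of reaching `F` in the Markov decision process of `P`. Player 2 has
exactly one strategy there, the empty one. -/
noncomputable def maxReach (P : NPP rng ι) (F : Set (Config rng)) : ℝ≥0∞ :=
  P.mdp.reachPP (Sum.inl '' F)

/-- The minimal probability of reaching `F` in the Markov decision process of `P`. -/
noncomputable def minReach (P : NPP rng ι) (F : Set (Config rng)) : ℝ≥0∞ :=
  P.mdp.reachMM (Sum.inl '' F)

/-- The computation does not get stuck: every run of the Markov decision process that ends in a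
configuration ends in a final one or in one that enables some guard. -/
def NeverStuck (P : NPP rng ι) (F : Set (Config rng)) : Prop :=
  ∀ (r : List (Config rng ⊕ Config rng × ι)) (σ : Config rng), P.mdp.IsRun (Sum.inl σ :: r) →
    σ ∈ F ∨ ∃ A, Transition.Enables σ (P.cmd A).guard

end NPP

/-! ## Valid abstractions -/

/-- The possible nodes of an abstraction of `P` over the abstract domain `D`: abstract states, the
distinguished states `○` and `⊗`, the pairs `⟨s, ○⟩` and `⟨s, A⟩`, and the tuples
`⟨s, A, s', d⟩`, where `d` assigns an abstract state to every update of `A`. -/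
inductive AbsNode {𝒱 : Type u} {rng : 𝒱 → Type v} {ι : Type w} (P : NPP rng ι) (D : Type x) :
    Type (max w x)
  | state (s : D) : AbsNode P D
  | circle : AbsNode P D
  | cross : AbsNode P D
  | proposeEnd (s : D) : AbsNode P D
  | propose (s : D) (A : ι) : AbsNode P D
  | resolve (s : D) (A : ι) (s' : D) (d : Fin (P.cmd A).m → D) : AbsNode P D

open AbsNode in
/-- The game `G` is a valid abstraction of `P` relative to `F` for the abstract domain `D` with
abstraction map `α` and concretization map `γ`. -/
structure IsValidAbstraction {𝒱 : Type u} {rng : 𝒱 → Type v} {ι : Type w} {D : Type x}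
    [CompleteLattice D] (P : NPP rng ι) (F : Set (Config rng))
    (α : Set (Config rng) → D) (γ : D → Set (Config rng))
    (G : StochasticGame (AbsNode P D)) : Prop where
  finite : G.V.Finite
  /-- The nodes of Player 1 are abstract states, `○` and `⊗`. -/
  V1_form : ∀ n ∈ G.V1, n = circle ∨ n = cross ∨ ∃ s, n = state s
  circle_mem : circle ∈ G.V1
  cross_mem : cross ∈ G.V1
  V2_form : ∀ n ∈ G.V2,
    (∃ s, n = proposeEnd s ∧ state s ∈ G.V1) ∨
    (∃ s A, n = propose s A ∧ state s ∈ G.V1 ∧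
      ∃ σ ∈ γ s, Transition.Enables σ (P.cmd A).guard)
  Vp_form : ∀ n ∈ G.Vp, ∃ s A s' d, n = resolve s A s' d ∧ state s ∈ G.V1 ∧ s' ≤ s ∧
    (∃ σ ∈ γ s', Transition.Enables σ (P.cmd A).guard) ∧
    ∀ j, state (d j) ∈ G.V1 ∧ (P.cmd A).c j (γ s') ⊆ γ (d j)
  start_eq : G.s0 = state (α {P.σ0})
  /-- From `s`, Player 1 can propose to end the play iff `γ s` contains a final state. -/
  state_end_iff : ∀ s, state s ∈ G.V1 →
    (G.E (state s) (proposeEnd s) ↔ (γ s ∩ F).Nonempty)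
  /-- From `s`, Player 1 can propose `A` iff some state of `γ s` enables `A`, except if all states
  of `γ s` are final. -/
  state_propose_iff : ∀ s A, state s ∈ G.V1 →
    (G.E (state s) (propose s A) ↔ ((P.cmd A).guard (γ s)).Nonempty ∧ ¬ γ s ⊆ F)
  /-- Player 1 has no other moves from `s`. -/
  state_succ : ∀ s n, state s ∈ G.V1 → G.E (state s) n → n = proposeEnd s ∨ ∃ A, n = propose s A
  /-- Player 2 can accept the proposal to end the play. -/
  end_accept : ∀ s, state s ∈ G.V1 → (γ s ∩ F).Nonempty → G.E (proposeEnd s) circle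
  /-- Player 2 has to accept it if all states of `γ s` are final. -/
  end_only : ∀ s, state s ∈ G.V1 → (γ s ∩ F).Nonempty → γ s ⊆ F →
    ∀ n, G.E (proposeEnd s) n → n = circle
  /-- Player 2 can reject it, by staying, if some state of `γ s` is not final. -/
  end_reject : ∀ s, state s ∈ G.V1 → (γ s ∩ F).Nonempty → ¬ γ s ⊆ F →
    G.E (proposeEnd s) (proposeEnd s)
  /-- Player 2 can accept `A` and choose `⟨s, A, s', d⟩`; the sets `γ s'` of these (finitely many)
  choices cover the states of `γ s` that enable `A`. -/
  propose_accept : ∀ s A, propose s A ∈ G.V2 →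
    (P.cmd A).guard (γ s) ⊆ ⋃ s' ∈ {s' | ∃ d, G.E (propose s A) (resolve s A s' d)}, γ s'
  propose_circle : ∀ s A, propose s A ∈ G.V2 → (γ s ∩ F).Nonempty → G.E (propose s A) circle
  propose_cross : ∀ s A, propose s A ∈ G.V2 → (P.cmd A).guard (γ s) ≠ γ s →
    G.E (propose s A) cross
  δ_eq : ∀ s A s' d, resolve s A s' d ∈ G.Vp →
    G.δ (resolve s A s' d) = (P.cmd A).p.map (fun j => state (d j))
  circle_dead : ∀ n, ¬ G.E circle n
  cross_dead : ∀ n, ¬ G.E cross n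

/-! A reachability probability is a supremum over finite horizons (`reach_eq_iSup`), so a bound
follows from a weight on nodes that behaves well along single moves. A weight that is at least 1 on
the target and does not increase in expectation bounds the probability from above (`reach_le`).
Bounds from below use weights indexed by the remaining steps that vanish off the target at horizon 0
(`le_reach`); without the index, a play that never reaches the target could keep its weight forever.

These certificates first identify the extremal values of the program with limits of value iteration
(`maxReach_eq`, `minReach_eq`). In the game, an abstract state `s` is then weighted by the infimum
(for upper bounds) or supremum (for lower bounds) of the program's values over configurations in `γ
s`. For `--` and `++` suitable strategies of both players are constructed; for `+-` and `-+` Player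
1 is arbitrary and Player 2 answers.

Player 2 can follow any single configuration: the covering condition provides a compatible successor
if the command is enabled (`exists_accept`), `○` is available if the configuration is final, and `⊗`
if the command is not enabled. Since nodes have finitely many successors, one best successor serves
all configurations of `γ s` at once (`exists_le_iInf`, `exists_iSup_le`). Disjointness plays no
role. -/

namespace StochasticGame

/-! ### Reachability as a limit over finite horizons -/

section Reach

variable {N : Type u} {G : StochasticGame N}

open Classical in
/-- The probability of prolonging a run by a node. -/
noncomputable def transProb (φ₁ : G.Strategy G.V1) (φ₂ : G.Strategy G.V2) : List N → N → ℝ≥0∞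
  | [], _ => 0
  | q :: w, z =>
      if q ∈ G.V1 then φ₁.prob (q :: w) z
      else if q ∈ G.V2 then φ₂.prob (q :: w) z
      else if q ∈ G.Vp then G.δ q z
      else 0

variable (φ₁ : G.Strategy G.V1) (φ₂ : G.Strategy G.V2) (T : Set N)

theorem val_cons_cons (z q : N) (w : List N) :
    G.val φ₁ φ₂ (z :: q :: w) = G.val φ₁ φ₂ (q :: w) * transProb φ₁ φ₂ (q :: w) z := by
  rw [val, transProb]

theorem Strategy.isRun_of_prob_ne_zero {U : Set N} (φ : G.Strategy U) {w : List N} {z : N}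
    (h : φ.prob w z ≠ 0) : G.IsRun (z :: w) := by
  unfold Strategy.prob at h
  split at h
  · next μ hμ => exact φ.admissible w μ hμ z (pos_iff_ne_zero.2 h)
  · exact absurd rfl h

theorem isRun_of_val_ne_zero {w : List N} (h : G.val φ₁ φ₂ w ≠ 0) : G.IsRun w := by
  induction w with
  | nil => simp [val] at h
  | cons z w ih =>
    cases w with
    | nil =>
      have : z = G.s0 := by
        by_contra hz
        simp [val, hz] at h
      subst this
      exact .start
    | cons q w =>
      rw [val_cons_cons] at h
      have h1 := ih (left_ne_zero_of_mul h)
      have h2 := right_ne_zero_of_mul h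
      rw [transProb] at h2
      split_ifs at h2 with a b c
      · exact φ₁.isRun_of_prob_ne_zero h2
      · exact φ₂.isRun_of_prob_ne_zero h2
      · exact .random h1 c (pos_iff_ne_zero.2 h2)
      · exact absurd rfl h2

open Classical in
/-- The probability of reaching `T` within `n` further steps, given the run so far. -/
noncomputable def reachWithin : ℕ → List N → ℝ≥0∞
  | _, [] => 0
  | 0, q :: _ => if q ∈ T then 1 else 0
  | n + 1, q :: w =>
      if q ∈ T then 1 else ∑' z, transProb φ₁ φ₂ (q :: w) z * reachWithin n (z :: q :: w)

/-- The expectation of `f` after `k` steps over the runs that avoid `T` before their last node. -/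
noncomputable def levelSum (k : ℕ) (f : List N → ℝ≥0∞) : ℝ≥0∞ :=
  ∑' w : List N,
    {w | w.length = k + 1 ∧ ∀ z ∈ w.tail, z ∉ T}.indicator (fun w => G.val φ₁ φ₂ w * f w) w

open Classical in
/-- Whether the last node of a run is in `T`. -/
noncomputable def lastMem : List N → ℝ≥0∞
  | [] => 0
  | q :: _ => if q ∈ T then 1 else 0

open Classical in
/-- The expectation of `f` after one more step, if `T` has not been reached. -/
noncomputable def stepExp (f : List N → ℝ≥0∞) : List N → ℝ≥0∞
  | [] => 0
  | q :: w => if q ∈ T then 0 else ∑' z, transProb φ₁ φ₂ (q :: w) z * f (z :: q :: w)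

theorem reachWithin_zero : reachWithin φ₁ φ₂ T 0 = lastMem T := by
  funext w
  cases w <;> simp [reachWithin, lastMem]

theorem reachWithin_succ (n : ℕ) :
    reachWithin φ₁ φ₂ T (n + 1) = lastMem T + stepExp φ₁ φ₂ T (reachWithin φ₁ φ₂ T n) := by
  funext w
  cases w with
  | nil => simp [reachWithin, lastMem, stepExp]
  | cons q w => by_cases h : q ∈ T <;> simp [reachWithin, lastMem, stepExp, h]

theorem tsum_list_eq (g : List N → ℝ≥0∞) :
    ∑' w, g w = g [] + ∑' (w : List N) (z : N), g (z :: w) := by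
  have h1 : Function.Injective fun p : List N × N => p.2 :: p.1 := by
    rintro ⟨w, z⟩ ⟨w', z'⟩ h
    simpa [and_comm] using h
  rw [ENNReal.tsum_eq_add_tsum_ite [], ← ENNReal.tsum_prod]
  congr 1
  rw [← h1.tsum_eq]
  · exact tsum_congr fun _ => if_neg (List.cons_ne_nil _ _)
  · intro w hw
    cases w with
    | nil => simp at hw
    | cons z w => exact ⟨(w, z), rfl⟩

theorem levelSum_zero (f : List N → ℝ≥0∞) : levelSum φ₁ φ₂ T 0 f = f [G.s0] := by
  unfold levelSum
  rw [tsum_eq_single [G.s0]]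
  · rw [Set.indicator_of_mem (by simp)]
    simp [val]
  · intro w hw
    match w with
    | [] => simp
    | [q] =>
      have : q ≠ G.s0 := fun h => hw (by rw [h])
      simp [val, this]
    | q :: r :: w => simp

/-- Runs store the newest node first, so splitting off the head of the list undoes the last step,
whose probability moves from `val` into `stepExp`. -/
theorem levelSum_succ (k : ℕ) (f : List N → ℝ≥0∞) :
    levelSum φ₁ φ₂ T (k + 1) f = levelSum φ₁ φ₂ T k (stepExp φ₁ φ₂ T f) := by
  unfold levelSum
  rw [tsum_list_eq, Set.indicator_of_notMem (by simp), zero_add]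
  refine tsum_congr fun w => ?_
  cases w with
  | nil => simp
  | cons q w =>
    by_cases hw : (q :: w) ∈ {w : List N | w.length = k + 1 ∧ ∀ z ∈ w.tail, z ∉ T}
    · rw [Set.indicator_of_mem hw]
      by_cases hq : q ∈ T
      · simp [stepExp, hq]
      · have hz (z : N) : (z :: q :: w) ∈
            {w : List N | w.length = k + 1 + 1 ∧ ∀ z ∈ w.tail, z ∉ T} := by
          simpa [hq] using hw
        simp only [Set.indicator_of_mem (hz _), val_cons_cons, stepExp, hq, if_false, mul_assoc,
          ENNReal.tsum_mul_left]
    · rw [Set.indicator_of_notMem hw, ENNReal.tsum_eq_zero]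
      intro z
      rw [Set.indicator_of_notMem]
      intro h
      refine hw ⟨by simpa using h.1, fun y hy => h.2 y ?_⟩
      simpa using Or.inr hy

theorem levelSum_add (k : ℕ) (f g : List N → ℝ≥0∞) :
    levelSum φ₁ φ₂ T k (f + g) = levelSum φ₁ φ₂ T k f + levelSum φ₁ φ₂ T k g := by
  unfold levelSum
  rw [← ENNReal.tsum_add]
  refine tsum_congr fun w => ?_
  by_cases hw : w ∈ {w : List N | w.length = k + 1 ∧ ∀ z ∈ w.tail, z ∉ T}
  · simp only [Set.indicator_of_mem hw, Pi.add_apply, mul_add]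
  · simp only [Set.indicator_of_notMem hw, add_zero]

/-- Unrolling the recursion of `reachWithin` trades each `stepExp` for one more level. -/
theorem levelSum_reachWithin (n k : ℕ) :
    levelSum φ₁ φ₂ T k (reachWithin φ₁ φ₂ T n) =
      ∑ i ∈ Finset.range (n + 1), levelSum φ₁ φ₂ T (k + i) (lastMem T) := by
  induction n generalizing k with
  | zero => simp [reachWithin_zero]
  | succ n ih =>
    rw [reachWithin_succ, levelSum_add, ← levelSum_succ, ih, Finset.sum_range_succ' _ (n + 1),
      add_comm]
    simp [add_assoc, add_comm 1]

theorem reach_eq_tsum_levelSum :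
    G.reach φ₁ φ₂ T = ∑' k, levelSum φ₁ φ₂ T k (lastMem T) := by
  unfold levelSum reach
  rw [ENNReal.tsum_comm]
  refine (tsum_subtype {w | G.IsAccepting T w} (G.val φ₁ φ₂)).trans (tsum_congr fun w => ?_)
  cases w with
  | nil => simp [val]
  | cons q w =>
    rw [tsum_eq_single w.length (fun k hk => Set.indicator_of_notMem
      (fun h => hk (by simpa using h.1.symm)) _)]
    -- The indicator in `levelSum` does not ask for a run; lists that are not runs drop out because
    -- `val` vanishes on them.
    by_cases h0 : G.val φ₁ φ₂ (q :: w) = 0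
    · rw [Set.indicator_apply_eq_zero.2 fun _ => h0, Set.indicator_apply_eq_zero.2 fun _ => by
        rw [h0, zero_mul]]
    have hr := isRun_of_val_ne_zero φ₁ φ₂ h0
    by_cases hq : q ∈ T ∧ ∀ z ∈ w, z ∉ T
    · rw [Set.indicator_of_mem (show _ ∈ {w | G.IsAccepting T w} from
        ⟨hr, q, w, rfl, hq⟩), Set.indicator_of_mem
          (show _ ∈ {v : List N | v.length = w.length + 1 ∧ ∀ z ∈ v.tail, z ∉ T} from
            ⟨by simp, by simpa using hq.2⟩)]
      simp [lastMem, hq.1]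
    · rw [Set.indicator_of_notMem]
      · symm
        rw [Set.indicator_apply_eq_zero]
        intro h
        have : q ∉ T := fun h' => hq ⟨h', h.2⟩
        simp [lastMem, this]
      · rintro ⟨-, y, w', h, hy⟩
        cases h
        exact hq hy

theorem reach_eq_iSup : G.reach φ₁ φ₂ T = ⨆ n, reachWithin φ₁ φ₂ T n [G.s0] := by
  rw [reach_eq_tsum_levelSum, ENNReal.tsum_eq_iSup_nat]
  have h (n : ℕ) : reachWithin φ₁ φ₂ T n [G.s0] =
      ∑ i ∈ Finset.range (n + 1), levelSum φ₁ φ₂ T i (lastMem T) := by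
    rw [← levelSum_zero φ₁ φ₂ T (reachWithin φ₁ φ₂ T n), levelSum_reachWithin]
    simp
  simp only [h]
  refine le_antisymm (iSup_le fun n => ?_) (iSup_le fun n => le_iSup_of_le (n + 1) le_rfl)
  exact le_iSup_of_le n (Finset.sum_le_sum_of_subset (Finset.range_mono (Nat.le_succ n)))

theorem IsRun.head_mem {q : N} {w : List N} (h : G.IsRun (q :: w)) :
    q ∈ G.V1 ∪ G.V2 ∪ G.Vp := by
  cases h with
  | start => exact .inl (.inl G.s0_mem)
  | player _ _ h => exact G.E_target h
  | random _ h h' => exact G.δ_target _ h ((PMF.mem_support_iff _ _).2 h'.ne')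

variable {T}

theorem transProb_of_mem_V1 {q : N} (w : List N) (h : q ∈ G.V1) (z : N) :
    transProb φ₁ φ₂ (q :: w) z = φ₁.prob (q :: w) z := by
  simp [transProb, h]

theorem transProb_of_mem_V2 {q : N} (w : List N) (h : q ∈ G.V2) (z : N) :
    transProb φ₁ φ₂ (q :: w) z = φ₂.prob (q :: w) z := by
  simp [transProb, h, G.disjoint12.notMem_of_mem_right h]

theorem transProb_of_mem_Vp {q : N} (w : List N) (h : q ∈ G.Vp) (z : N) :
    transProb φ₁ φ₂ (q :: w) z = G.δ q z := by
  simp [transProb, h, G.disjoint1p.notMem_of_mem_right h, G.disjoint2p.notMem_of_mem_right h]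

/-! ### Weight certificates for upper and lower bounds -/

variable {φ₁ φ₂}

theorem isRun_of_transProb_ne_zero {q z : N} {w : List N} (hw : G.IsRun (q :: w))
    (h : transProb φ₁ φ₂ (q :: w) z ≠ 0) : G.IsRun (z :: q :: w) := by
  rcases hw.head_mem with (hq | hq) | hq
  · rw [transProb_of_mem_V1 _ _ _ hq] at h
    exact φ₁.isRun_of_prob_ne_zero h
  · rw [transProb_of_mem_V2 _ _ _ hq] at h
    exact φ₂.isRun_of_prob_ne_zero h
  · rw [transProb_of_mem_Vp _ _ _ hq] at h
    exact .random hw hq (pos_iff_ne_zero.2 h)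

/-- Playing `φ`, the value of `W` does not increase in expectation outside `T`. -/
def Strategy.Lowers {U : Set N} (φ : G.Strategy U) (T : Set N) (W : N → ℝ≥0∞) : Prop :=
  ∀ q w, G.IsRun (q :: w) → q ∈ U → q ∉ T → ∑' z, φ.prob (q :: w) z * W z ≤ W q

/-- Playing `φ` for `n` steps, the value of `W`, indexed by the number of remaining steps, does not
decrease in expectation outside `T`. -/
def Strategy.Raises {U : Set N} (φ : G.Strategy U) (T : Set N) (n : ℕ) (W : ℕ → N → ℝ≥0∞) : Prop :=
  ∀ m q w, G.IsRun (q :: w) → q ∈ U → q ∉ T → m + 1 + w.length = n →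
    W (m + 1) q ≤ ∑' z, φ.prob (q :: w) z * W m z

theorem reach_le {W : N → ℝ≥0∞} (hT : ∀ q ∈ T, 1 ≤ W q) (h₁ : φ₁.Lowers T W) (h₂ : φ₂.Lowers T W)
    (hp : ∀ q ∈ G.Vp, q ∉ T → ∑' z, G.δ q z * W z ≤ W q) :
    G.reach φ₁ φ₂ T ≤ W G.s0 := by
  have key (n : ℕ) : ∀ q w, G.IsRun (q :: w) → reachWithin φ₁ φ₂ T n (q :: w) ≤ W q := by
    induction n with
    | zero =>
      intro q w _
      by_cases hq : q ∈ T <;> simp [reachWithin, hq, hT]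
    | succ n ih =>
      intro q w hw
      by_cases hq : q ∈ T
      · simp [reachWithin, hq, hT]
      · rw [reachWithin, if_neg hq]
        have : ∑' z, transProb φ₁ φ₂ (q :: w) z * reachWithin φ₁ φ₂ T n (z :: q :: w) ≤
            ∑' z, transProb φ₁ φ₂ (q :: w) z * W z := by
          refine ENNReal.tsum_le_tsum fun z => ?_
          by_cases hz : transProb φ₁ φ₂ (q :: w) z = 0
          · simp [hz]
          · exact mul_le_mul_right (ih z _ (isRun_of_transProb_ne_zero hw hz)) _
        refine this.trans ?_
        rcases hw.head_mem with (hm | hm) | hm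
        · simpa only [transProb_of_mem_V1 _ _ _ hm] using h₁ q w hw hm hq
        · simpa only [transProb_of_mem_V2 _ _ _ hm] using h₂ q w hw hm hq
        · simpa only [transProb_of_mem_Vp _ _ _ hm] using hp q hm hq
  rw [reach_eq_iSup]
  exact iSup_le fun n => key n _ _ .start

/-- The induction only visits runs with `m + w.length = n`, so the remaining horizon can be read off
the run and a strategy may depend on it. -/
theorem le_reach {n : ℕ} {W : ℕ → N → ℝ≥0∞} (hT : ∀ m, ∀ q ∈ T, W m q ≤ 1)
    (h0 : ∀ q ∉ T, W 0 q = 0) (h₁ : φ₁.Raises T n W) (h₂ : φ₂.Raises T n W)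
    (hp : ∀ m, ∀ q ∈ G.Vp, q ∉ T → W (m + 1) q ≤ ∑' z, G.δ q z * W m z) :
    W n G.s0 ≤ G.reach φ₁ φ₂ T := by
  have key (m : ℕ) : ∀ q w, G.IsRun (q :: w) → m + w.length = n →
      W m q ≤ reachWithin φ₁ φ₂ T m (q :: w) := by
    induction m with
    | zero =>
      intro q w _ _
      by_cases hq : q ∈ T <;> simp [reachWithin, hq, hT, h0]
    | succ m ih =>
      intro q w hw hn
      by_cases hq : q ∈ T
      · simp [reachWithin, hq, hT]
      · rw [reachWithin, if_neg hq]
        have : ∑' z, transProb φ₁ φ₂ (q :: w) z * W m z ≤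
            ∑' z, transProb φ₁ φ₂ (q :: w) z * reachWithin φ₁ φ₂ T m (z :: q :: w) := by
          refine ENNReal.tsum_le_tsum fun z => ?_
          by_cases hz : transProb φ₁ φ₂ (q :: w) z = 0
          · simp [hz]
          · refine mul_le_mul_right (ih z _ (isRun_of_transProb_ne_zero hw hz) ?_) _
            rw [List.length_cons]
            omega
        refine le_trans ?_ this
        rcases hw.head_mem with (hm | hm) | hm
        · simpa only [transProb_of_mem_V1 _ _ _ hm] using h₁ m q w hw hm hq hn
        · simpa only [transProb_of_mem_V2 _ _ _ hm] using h₂ m q w hw hm hq hn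
        · simpa only [transProb_of_mem_Vp _ _ _ hm] using hp m q hm hq
  rw [reach_eq_iSup]
  exact le_iSup_of_le n (key n _ _ .start (by simp))

end Reach

/-! ### Strategies from local conditions on moves -/

section Player

variable {N : Type u} {G : StochasticGame N} {U T : Set N}

theorem edge_of_isRun {q z : N} {w : List N} (hq : q ∈ G.V1 ∪ G.V2) (h : G.IsRun (z :: q :: w)) :
    G.E q z := by
  cases h with
  | player _ _ h => exact h
  | random _ h _ =>
    rcases hq with hq | hq
    · exact absurd h (G.disjoint1p.notMem_of_mem_left hq)
    · exact absurd h (G.disjoint2p.notMem_of_mem_left hq)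

theorem Strategy.edge_of_prob_ne_zero (φ : G.Strategy U) (hU : U ⊆ G.V1 ∪ G.V2) {q z : N}
    {w : List N} (hq : q ∈ U) (h : φ.prob (q :: w) z ≠ 0) : G.E q z :=
  edge_of_isRun (hU hq) (φ.isRun_of_prob_ne_zero h)

theorem Strategy.tsum_prob (φ : G.Strategy U) {q : N} {w : List N} (hw : G.IsRun (q :: w))
    (hq : q ∈ U) (h : ∃ z, G.E q z) : ∑' z, φ.prob (q :: w) z = 1 := by
  obtain ⟨μ, hμ⟩ := Option.isSome_iff_exists.1 ((φ.defined_iff (q :: w)).2 ⟨hw, q, w, rfl, hq, h⟩)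
  simp only [Strategy.prob, hμ]
  exact μ.tsum_coe

theorem Strategy.tsum_prob_le_one (φ : G.Strategy U) (w : List N) : ∑' z, φ.prob w z ≤ 1 := by
  unfold Strategy.prob
  split
  · next μ _ => exact μ.tsum_coe.le
  · simp

theorem Strategy.lowers (φ : G.Strategy U) (hU : U ⊆ G.V1 ∪ G.V2) {W : N → ℝ≥0∞}
    (h : ∀ q ∈ U, q ∉ T → ∀ z, G.E q z → W z ≤ W q) : φ.Lowers T W := by
  intro q w _ hq hqT
  calc ∑' z, φ.prob (q :: w) z * W z ≤ ∑' z, φ.prob (q :: w) z * W q := by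
        refine ENNReal.tsum_le_tsum fun z => ?_
        by_cases hz : φ.prob (q :: w) z = 0
        · simp [hz]
        · exact mul_le_mul_right (h q hq hqT z (φ.edge_of_prob_ne_zero hU hq hz)) _
    _ = (∑' z, φ.prob (q :: w) z) * W q := ENNReal.tsum_mul_right
    _ ≤ W q := mul_le_of_le_one_left' (φ.tsum_prob_le_one _)

/-- Unlike for `Strategy.lowers`, total mass at most 1 is not enough: at a dead end the mass is 0,
so the weight must vanish there. -/
theorem Strategy.raises (φ : G.Strategy U) (hU : U ⊆ G.V1 ∪ G.V2) (n : ℕ) {W : ℕ → N → ℝ≥0∞}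
    (h : ∀ m q w, G.IsRun (q :: w) → q ∈ U → q ∉ T →
      (W (m + 1) q = 0 ∨ ∃ z, G.E q z) ∧ ∀ z, G.E q z → W (m + 1) q ≤ W m z) :
    φ.Raises T n W := by
  intro m q w hw hq hqT _
  obtain ⟨h1 | h1, h2⟩ := h m q w hw hq hqT
  · simp [h1]
  calc W (m + 1) q = (∑' z, φ.prob (q :: w) z) * W (m + 1) q := by
        rw [φ.tsum_prob hw hq h1, one_mul]
    _ = ∑' z, φ.prob (q :: w) z * W (m + 1) q := ENNReal.tsum_mul_right.symm
    _ ≤ _ := by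
        refine ENNReal.tsum_le_tsum fun z => ?_
        by_cases hz : φ.prob (q :: w) z = 0
        · simp [hz]
        · exact mul_le_mul_right (h2 z (φ.edge_of_prob_ne_zero hU hq hz)) _

open Classical in
/-- The pure strategy that makes the moves prescribed by `f`. -/
noncomputable def Strategy.ofSelection (hU : U ⊆ G.V1 ∪ G.V2) (f : N → List N → N)
    (hf : ∀ q w, q ∈ U → (∃ z, G.E q z) → G.E q (f q w)) : G.Strategy U where
  choice
    | [] => none
    | q :: w => if G.IsRun (q :: w) ∧ q ∈ U ∧ ∃ z, G.E q z then some (PMF.pure (f q w)) else none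
  defined_iff w := by
    cases w with
    | nil => simp
    | cons q w =>
      by_cases h : G.IsRun (q :: w) ∧ q ∈ U ∧ ∃ z, G.E q z
      · dsimp only
        rw [if_pos h]
        exact ⟨fun _ => ⟨h.1, q, w, rfl, h.2⟩, fun _ => rfl⟩
      · dsimp only
        rw [if_neg h]
        refine ⟨fun h' => by simp at h', ?_⟩
        rintro ⟨h1, y, w', h2, h3⟩
        cases h2
        exact absurd ⟨h1, h3⟩ h
  finite_support w μ h := by
    cases w with
    | nil => simp at h
    | cons q w =>
      dsimp only at h
      split_ifs at h
      cases h
      simp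
  admissible w μ h z hz := by
    cases w with
    | nil => simp at h
    | cons q w =>
      dsimp only at h
      split_ifs at h with h1
      cases h
      have : z = f q w := by
        by_contra hne
        simp [PMF.pure_apply, hne] at hz
      subst this
      exact .player h1.1 (hU h1.2.1) (hf q w h1.2.1 h1.2.2)

theorem Strategy.tsum_ofSelection (hU : U ⊆ G.V1 ∪ G.V2) (f : N → List N → N)
    (hf : ∀ q w, q ∈ U → (∃ z, G.E q z) → G.E q (f q w)) {q : N} {w : List N}
    (hw : G.IsRun (q :: w)) (hq : q ∈ U) (h : ∃ z, G.E q z) (W : N → ℝ≥0∞) :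
    ∑' z, (Strategy.ofSelection hU f hf).prob (q :: w) z * W z = W (f q w) := by
  have : ∀ z, (Strategy.ofSelection hU f hf).prob (q :: w) z = PMF.pure (f q w) z := by
    intro z
    have h' : G.IsRun (q :: w) ∧ q ∈ U ∧ ∃ z, G.E q z := ⟨hw, hq, h⟩
    simp only [Strategy.prob, Strategy.ofSelection]
    rw [if_pos h']
  simp only [this]
  rw [tsum_eq_single (f q w)]
  · simp
  · intro z hz
    simp [PMF.pure_apply, hz]

theorem exists_lowers (hU : U ⊆ G.V1 ∪ G.V2) {W : N → ℝ≥0∞}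
    (h : ∀ q ∈ U, q ∉ T → (∃ z, G.E q z) → ∃ z, G.E q z ∧ W z ≤ W q) :
    ∃ φ : G.Strategy U, φ.Lowers T W := by
  have (q : N) : ∃ z, (q ∈ U → (∃ z, G.E q z) → G.E q z ∧ (q ∉ T → W z ≤ W q)) := by
    by_cases h1 : q ∈ U ∧ ∃ z, G.E q z
    · by_cases h2 : q ∈ T
      · obtain ⟨z, hz⟩ := h1.2
        exact ⟨z, fun _ _ => ⟨hz, fun h => absurd h2 h⟩⟩
      · obtain ⟨z, hz, hz'⟩ := h q h1.1 h2 h1.2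
        exact ⟨z, fun _ _ => ⟨hz, fun _ => hz'⟩⟩
    · exact ⟨q, fun a b => absurd ⟨a, b⟩ h1⟩
  choose f hf using this
  refine ⟨.ofSelection hU (fun q _ => f q) fun q _ a b => (hf q a b).1, ?_⟩
  intro q w hw hq hqT
  by_cases h1 : ∃ z, G.E q z
  · rw [Strategy.tsum_ofSelection hU _ _ hw hq h1]
    exact (hf q hq h1).2 hqT
  · refine (ENNReal.tsum_eq_zero.2 fun z => ?_).trans_le zero_le
    rw [mul_eq_zero]
    exact .inl (by_contra fun hz => h1 ⟨z, Strategy.edge_of_prob_ne_zero _ hU hq hz⟩)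

theorem exists_raises (hU : U ⊆ G.V1 ∪ G.V2) (n : ℕ) {W : ℕ → N → ℝ≥0∞}
    (h : ∀ m, ∀ q ∈ U, q ∉ T → W (m + 1) q = 0 ∨ ∃ z, G.E q z ∧ W (m + 1) q ≤ W m z) :
    ∃ φ : G.Strategy U, φ.Raises T n W := by
  have (m : ℕ) (q : N) : ∃ z, (q ∈ U → (∃ z, G.E q z) → G.E q z ∧
      (q ∉ T → W (m + 1) q ≤ W m z)) := by
    by_cases h1 : q ∈ U ∧ ∃ z, G.E q z
    · by_cases h2 : q ∈ T
      · obtain ⟨z, hz⟩ := h1.2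
        exact ⟨z, fun _ _ => ⟨hz, fun h => absurd h2 h⟩⟩
      · obtain h3 | ⟨z, hz, hz'⟩ := h m q h1.1 h2
        · obtain ⟨z, hz⟩ := h1.2
          exact ⟨z, fun _ _ => ⟨hz, fun _ => by simp [h3]⟩⟩
        · exact ⟨z, fun _ _ => ⟨hz, fun _ => hz'⟩⟩
    · exact ⟨q, fun a b => absurd ⟨a, b⟩ h1⟩
  choose f hf using this
  -- The index is the solution `m` of `m + 1 + w.length = n`, the number of steps left after this
  -- move.
  refine ⟨.ofSelection hU (fun q w => f (n - w.length - 1) q) fun q _ a b => (hf _ q a b).1, ?_⟩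
  intro m q w hw hq hqT hn
  by_cases h1 : ∃ z, G.E q z
  · rw [Strategy.tsum_ofSelection hU _ _ hw hq h1, show n - w.length - 1 = m by omega]
    exact (hf m q hq h1).2 hqT
  · obtain h3 | ⟨z, hz, -⟩ := h m q hq hqT
    · simp [h3]
    · exact absurd ⟨z, hz⟩ h1

end Player

end StochasticGame

/-! ### Guards, assignments and expectations of commands -/

theorem PMF.tsum_map_mul {α : Type*} {β : Type*} (p : PMF α) (f : α → β) (W : β → ℝ≥0∞) :
    ∑' z, p.map f z * W z = ∑' a, p a * W (f a) := by
  classical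
  simp only [PMF.map_apply, ← ENNReal.tsum_mul_right]
  rw [ENNReal.tsum_comm]
  refine tsum_congr fun a => ?_
  rw [tsum_eq_single (f a)]
  · simp
  · intro z hz
    simp [hz]

namespace Transition

variable {S : Type u} {g : Transition S}

theorem IsGuard.apply_eq (hg : g.IsGuard) (M : Set S) : g M = {σ ∈ M | Enables σ g} := by
  rw [← g.iUnion_eq]
  ext τ
  simp only [Set.mem_iUnion, Set.mem_ofPred_eq, Enables, exists_prop]
  constructor
  · rintro ⟨σ, hσ, h⟩
    rcases hg σ with h' | h'
    · rw [h', Set.mem_singleton_iff] at h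
      subst h
      exact ⟨hσ, h'⟩
    · simp [h'] at h
  · rintro ⟨hτ, h⟩
    exact ⟨τ, hτ, by rw [h]; rfl⟩

theorem IsAssignment.sem_mem {c : Transition S} (hc : c.IsAssignment) {M : Set S} {σ : S}
    (hσ : σ ∈ M) : hc.sem σ ∈ c M := by
  rw [← c.iUnion_eq]
  exact Set.mem_biUnion hσ (by rw [hc.sem_spec]; rfl)

end Transition

namespace GuardedCommand

variable {S : Type u} (A : GuardedCommand S)

/-- The expectation of `f` after executing the command in the configuration `σ`. -/
noncomputable def expect (f : S → ℝ≥0∞) (σ : S) : ℝ≥0∞ :=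
  ∑ j, A.p j * f ((A.isAssignment j).sem σ)

theorem expect_mono {f g : S → ℝ≥0∞} (h : f ≤ g) (σ : S) : A.expect f σ ≤ A.expect g σ :=
  Finset.sum_le_sum fun _ _ => mul_le_mul_right (h _) _

theorem expect_iSup {f : ℕ → S → ℝ≥0∞} (hf : Monotone f) (σ : S) :
    A.expect (fun σ => ⨆ n, f n σ) σ = ⨆ n, A.expect (f n) σ := by
  unfold expect
  simp only [ENNReal.mul_iSup]
  exact ENNReal.finsetSum_iSup_of_monotone fun j m n h => mul_le_mul_right (hf h _) _

theorem expect_le_one {f : S → ℝ≥0∞} (hf : ∀ σ, f σ ≤ 1) (σ : S) : A.expect f σ ≤ 1 :=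
  calc A.expect f σ ≤ ∑ j, A.p j := Finset.sum_le_sum fun _ _ => mul_le_of_le_one_right' (hf _)
    _ = 1 := by rw [← tsum_fintype (L := .unconditional _), A.p.tsum_coe]

end GuardedCommand

/-! ### Value iteration for programs -/

namespace NPP

variable {𝒱 : Type u} {rng : 𝒱 → Type v} {ι : Type w} (P : NPP rng ι) (F : Set (Config rng))

open Classical in
/-- The maximal probability of reaching `F` in fewer than `n` commands. -/
noncomputable def maxVal : ℕ → Config rng → ℝ≥0∞
  | 0, _ => 0
  | n + 1, σ => if σ ∈ F then 1 else
      ⨆ (A : ι) (_ : Transition.Enables σ (P.cmd A).guard), (P.cmd A).expect (maxVal n) σ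

open Classical in
/-- The minimal probability of reaching `F` in fewer than `n` commands; stuck configurations count
as final. -/
noncomputable def minVal : ℕ → Config rng → ℝ≥0∞
  | 0, _ => 0
  | n + 1, σ => if σ ∈ F then 1 else
      1 ⊓ ⨅ (A : ι) (_ : Transition.Enables σ (P.cmd A).guard), (P.cmd A).expect (minVal n) σ

variable {P F}

theorem maxVal_mono : Monotone (P.maxVal F) := by
  refine monotone_nat_of_le_succ fun n => ?_
  induction n with
  | zero => exact fun σ => zero_le
  | succ n ih =>
    intro σ
    rw [maxVal, maxVal]
    split_ifs
    · rfl
    · exact iSup₂_mono fun A _ => (P.cmd A).expect_mono ih σ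

theorem minVal_mono : Monotone (P.minVal F) := by
  refine monotone_nat_of_le_succ fun n => ?_
  induction n with
  | zero => exact fun σ => zero_le
  | succ n ih =>
    intro σ
    rw [minVal, minVal]
    split_ifs
    · rfl
    · exact inf_le_inf_left _ (iInf₂_mono fun A _ => (P.cmd A).expect_mono ih σ)

theorem maxVal_le_one_of_mem {σ : Config rng} (h : σ ∈ F) (n : ℕ) : P.maxVal F n σ ≤ 1 := by
  cases n <;> simp [maxVal, h]

theorem minVal_le_one (n : ℕ) (σ : Config rng) : P.minVal F n σ ≤ 1 := by
  cases n with
  | zero => simp [minVal]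
  | succ n =>
    rw [minVal]
    split_ifs
    · rfl
    · exact inf_le_left

theorem one_le_iSup_maxVal {σ : Config rng} (h : σ ∈ F) : 1 ≤ ⨆ n, P.maxVal F n σ :=
  le_iSup_of_le 1 (by simp [maxVal, h])

theorem one_le_iSup_minVal {σ : Config rng} (h : σ ∈ F) : 1 ≤ ⨆ n, P.minVal F n σ :=
  le_iSup_of_le 1 (by simp [minVal, h])

theorem expect_iSup_maxVal_le {σ : Config rng} (hσ : σ ∉ F) {A : ι}
    (hA : Transition.Enables σ (P.cmd A).guard) :
    (P.cmd A).expect (fun σ => ⨆ n, P.maxVal F n σ) σ ≤ ⨆ n, P.maxVal F n σ := by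
  rw [GuardedCommand.expect_iSup _ maxVal_mono]
  refine iSup_le fun n => le_iSup_of_le (n + 1) ?_
  rw [maxVal, if_neg hσ]
  exact le_iSup₂_of_le A hA le_rfl

theorem maxVal_succ_le [Finite ι] {σ : Config rng} (hσ : σ ∉ F) (n : ℕ) :
    P.maxVal F (n + 1) σ = 0 ∨ ∃ A, Transition.Enables σ (P.cmd A).guard ∧
      P.maxVal F (n + 1) σ ≤ (P.cmd A).expect (P.maxVal F n) σ := by
  rw [maxVal, if_neg hσ]
  by_cases h : ∃ A, Transition.Enables σ (P.cmd A).guard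
  · obtain ⟨A, hA, hmax⟩ := Set.exists_max_image {A | Transition.Enables σ (P.cmd A).guard}
      (fun A => (P.cmd A).expect (P.maxVal F n) σ) (Set.toFinite _) h
    exact .inr ⟨A, hA, iSup₂_le hmax⟩
  · push Not at h
    exact .inl (by simp [h])

theorem minVal_succ_le {σ : Config rng} (hσ : σ ∉ F) {A : ι}
    (hA : Transition.Enables σ (P.cmd A).guard) (n : ℕ) :
    P.minVal F (n + 1) σ ≤ (P.cmd A).expect (P.minVal F n) σ := by
  rw [minVal, if_neg hσ]
  exact inf_le_right.trans (iInf₂_le A hA)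

theorem expect_minVal_le [Finite ι] {σ : Config rng} (hσ : σ ∉ F)
    (h : ∃ A, Transition.Enables σ (P.cmd A).guard) (n : ℕ) :
    ∃ A, Transition.Enables σ (P.cmd A).guard ∧
      (P.cmd A).expect (P.minVal F n) σ ≤ P.minVal F (n + 1) σ := by
  obtain ⟨A, hA, hmin⟩ := Set.exists_min_image {A | Transition.Enables σ (P.cmd A).guard}
    (fun A => (P.cmd A).expect (P.minVal F n) σ) (Set.toFinite _) h
  refine ⟨A, hA, ?_⟩
  rw [minVal, if_neg hσ]
  exact le_inf ((P.cmd A).expect_le_one (minVal_le_one n) σ) (le_iInf₂ hmin)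

/-- The optimal command may change with the horizon. As there are finitely many, one of them is
optimal for infinitely many horizons, and monotonicity in the horizon carries its bound to the
limit. -/
theorem expect_iSup_minVal_le [Finite ι] {σ : Config rng} (hσ : σ ∉ F)
    (h : ∃ A, Transition.Enables σ (P.cmd A).guard) :
    ∃ A, Transition.Enables σ (P.cmd A).guard ∧
      (P.cmd A).expect (fun σ => ⨆ n, P.minVal F n σ) σ ≤ ⨆ n, P.minVal F n σ := by
  choose f hf hf' using expect_minVal_le (P := P) hσ h
  obtain ⟨A, hA⟩ := Finite.exists_infinite_fiber f
  have hA := Set.infinite_coe_iff.1 hA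
  obtain ⟨k, hk⟩ := hA.nonempty
  refine ⟨A, hk ▸ hf k, ?_⟩
  rw [GuardedCommand.expect_iSup _ minVal_mono]
  refine iSup_le fun n => ?_
  obtain ⟨m, hm, hnm⟩ := hA.exists_gt n
  rw [Set.mem_preimage, Set.mem_singleton_iff] at hm
  calc (P.cmd A).expect (P.minVal F n) σ ≤ (P.cmd A).expect (P.minVal F m) σ :=
        (P.cmd A).expect_mono (minVal_mono hnm.le) σ
    _ ≤ P.minVal F (m + 1) σ := hm ▸ hf' m
    _ ≤ _ := le_iSup (fun n => P.minVal F n σ) (m + 1)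

theorem tsum_mdp_δ (σ : Config rng) (A : ι) (W : Config rng ⊕ Config rng × ι → ℝ≥0∞) :
    ∑' z, P.mdp.δ (.inr (σ, A)) z * W z = (P.cmd A).expect (fun σ => W (.inl σ)) σ :=
  (PMF.tsum_map_mul _ _ W).trans (tsum_fintype _)

variable (P) in
/-- Node weights of the MDP for given weights of configurations. -/
noncomputable def mdpWeight (f : Config rng → ℝ≥0∞) : Config rng ⊕ Config rng × ι → ℝ≥0∞
  | .inl σ => f σ
  | .inr (σ, A) => (P.cmd A).expect f σ

variable (P) in
/-- Node weights of the MDP with `m` steps remaining, for given weights of configurations with `k`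
commands remaining. -/
noncomputable def mdpWeightWithin (f : ℕ → Config rng → ℝ≥0∞) (m : ℕ) :
    Config rng ⊕ Config rng × ι → ℝ≥0∞
  | .inl σ => f (m / 2) σ
  | .inr (σ, A) => Nat.casesOn ((m + 1) / 2) 0 fun k => (P.cmd A).expect (f k) σ

theorem mdp_le_reach {φ₁ : P.mdp.Strategy P.mdp.V1} {φ₂ : P.mdp.Strategy P.mdp.V2}
    {f : ℕ → Config rng → ℝ≥0∞} {n : ℕ} (h0 : ∀ σ, f 0 σ = 0) (hF : ∀ n, ∀ σ ∈ F, f n σ ≤ 1)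
    (h : φ₁.Raises (Sum.inl '' F) (2 * n) (P.mdpWeightWithin f)) :
    f n P.σ0 ≤ P.mdp.reach φ₁ φ₂ (Sum.inl '' F) := by
  have key := StochasticGame.le_reach (φ₁ := φ₁) (φ₂ := φ₂) (T := Sum.inl '' F) (n := 2 * n)
    (W := P.mdpWeightWithin f) ?_ ?_ h (fun _ _ _ _ hq => absurd hq (Set.notMem_empty _)) ?_
  · change f (2 * n / 2) P.σ0 ≤ _ at key
    rwa [Nat.mul_div_cancel_left n two_pos] at key
  · rintro m _ ⟨σ, hσ, rfl⟩
    exact hF _ σ hσ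
  · rintro (σ | ⟨σ, A⟩) _
    · exact h0 σ
    · rfl
  · rintro m _ ⟨⟨σ, A⟩, rfl⟩ _
    rw [tsum_mdp_δ]
    unfold mdpWeightWithin
    -- A command takes two steps of the decision process; the rounding makes the random step the one
    -- that uses up a command.
    simp only [show (m + 1 + 1) / 2 = m / 2 + 1 by omega]
    rfl

theorem mdp_reach_le {φ₁ : P.mdp.Strategy P.mdp.V1} {φ₂ : P.mdp.Strategy P.mdp.V2}
    {f : Config rng → ℝ≥0∞} (hF : ∀ σ ∈ F, 1 ≤ f σ)
    (h : φ₁.Lowers (Sum.inl '' F) (P.mdpWeight f)) :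
    P.mdp.reach φ₁ φ₂ (Sum.inl '' F) ≤ f P.σ0 := by
  refine StochasticGame.reach_le (W := P.mdpWeight f) ?_ h
    (fun _ _ _ hq => absurd hq (Set.notMem_empty _)) ?_
  · rintro _ ⟨σ, hσ, rfl⟩
    exact hF σ hσ
  · rintro _ ⟨⟨σ, A⟩, rfl⟩ _
    rw [tsum_mdp_δ]
    rfl

/-- Otherwise the extrema over Player 2's strategies would be extrema over the empty set. -/
theorem exists_strategy_V2 : Nonempty (P.mdp.Strategy P.mdp.V2) :=
  ⟨(StochasticGame.exists_lowers (T := ∅) (W := 0) Set.subset_union_right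
    fun _ h => absurd h (Set.notMem_empty _)).choose⟩

theorem maxReach_eq [Finite ι] : P.maxReach F = ⨆ n, P.maxVal F n P.σ0 := by
  refine le_antisymm (iSup₂_le fun φ₁ φ₂ => ?_) (iSup_le fun n => ?_)
  · refine mdp_reach_le (f := fun σ => ⨆ n, P.maxVal F n σ)
      (fun σ hσ => one_le_iSup_maxVal hσ) (φ₁.lowers Set.subset_union_left ?_)
    rintro _ ⟨σ, rfl⟩ hσ _ ⟨_, A, ⟨⟩, rfl, hA⟩
    exact expect_iSup_maxVal_le (fun h => hσ ⟨σ, h, rfl⟩) hA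
  · obtain ⟨φ₂⟩ := exists_strategy_V2 (P := P)
    have : ∃ φ : P.mdp.Strategy P.mdp.V1,
        φ.Raises (Sum.inl '' F) (2 * n) (P.mdpWeightWithin (P.maxVal F)) := ?_
    · obtain ⟨φ₁, h⟩ := this
      exact le_iSup₂_of_le φ₁ φ₂ (mdp_le_reach (fun _ => rfl)
        (fun n σ hσ => maxVal_le_one_of_mem hσ n) h)
    · refine StochasticGame.exists_raises Set.subset_union_left _ ?_
      rintro m _ ⟨σ, rfl⟩ hσ
      have hσ : σ ∉ F := fun h => hσ ⟨σ, h, rfl⟩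
      simp only [mdpWeightWithin]
      cases hk : (m + 1) / 2 with
      | zero => exact .inl rfl
      | succ k =>
        refine (maxVal_succ_le hσ k).imp_right ?_
        rintro ⟨A, hA, h⟩
        refine ⟨.inr (σ, A), ⟨σ, A, rfl, rfl, hA⟩, ?_⟩
        simp only
        exact h

theorem minReach_eq [Finite ι] (hP : P.NeverStuck F) :
    P.minReach F = ⨆ n, P.minVal F n P.σ0 := by
  refine le_antisymm ?_ (iSup_le fun n => le_iInf₂ fun φ₁ φ₂ => ?_)
  · obtain ⟨φ₂⟩ := exists_strategy_V2 (P := P)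
    have : ∃ φ : P.mdp.Strategy P.mdp.V1,
        φ.Lowers (Sum.inl '' F) (P.mdpWeight fun σ => ⨆ n, P.minVal F n σ) := ?_
    · obtain ⟨φ₁, h⟩ := this
      exact iInf₂_le_of_le φ₁ φ₂ (mdp_reach_le (f := fun σ => ⨆ n, P.minVal F n σ)
        (fun σ hσ => one_le_iSup_minVal hσ) h)
    · refine StochasticGame.exists_lowers Set.subset_union_left ?_
      rintro _ ⟨σ, rfl⟩ hσ ⟨_, _, A, ⟨⟩, rfl, hA⟩
      obtain ⟨B, hB, h⟩ := expect_iSup_minVal_le (fun h => hσ ⟨σ, h, rfl⟩) ⟨A, hA⟩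
      exact ⟨.inr (σ, B), ⟨σ, B, rfl, rfl, hB⟩, h⟩
  · refine mdp_le_reach (fun _ => rfl) (fun n σ _ => minVal_le_one n σ)
      (φ₁.raises Set.subset_union_left _ ?_)
    rintro m _ w hw ⟨σ, rfl⟩ hσ
    have hσ : σ ∉ F := fun h => hσ ⟨σ, h, rfl⟩
    -- A stuck configuration outside `F` has `minVal` 1 at positive horizons although `F` is never
    -- reached from it; `NeverStuck` excludes this along runs.
    obtain ⟨A, hA⟩ := (hP w σ hw).resolve_left hσ
    refine ⟨.inr ⟨.inr (σ, A), σ, A, rfl, rfl, hA⟩, ?_⟩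
    rintro _ ⟨_, B, ⟨⟩, rfl, hB⟩
    simp only [mdpWeightWithin]
    cases (m + 1) / 2 with
    | zero => rfl
    | succ k => exact minVal_succ_le hσ hB k

variable (P) in
/-- The configurations that occur at the end of some run. -/
def reachable : Set (Config rng) := {σ | ∃ r, P.mdp.IsRun (.inl σ :: r)}

theorem σ0_mem_reachable : P.σ0 ∈ P.reachable := ⟨[], .start⟩

/-- `γ s` may contain stuck configurations that no run visits, so the weights for minimal
reachability only use reachable ones. Updates of probability 0 are excluded, as they may leave this
set. -/
theorem sem_mem_reachable {σ : Config rng} (hσ : σ ∈ P.reachable) {A : ι}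
    (hA : Transition.Enables σ (P.cmd A).guard) {j : Fin (P.cmd A).m} (hj : (P.cmd A).p j ≠ 0) :
    ((P.cmd A).isAssignment j).sem σ ∈ P.reachable := by
  obtain ⟨r, hr⟩ := hσ
  refine ⟨_, .random (.player hr (.inl ⟨σ, rfl⟩) ⟨σ, A, rfl, rfl, hA⟩) ⟨(σ, A), rfl⟩ ?_⟩
  refine pos_iff_ne_zero.2 ((PMF.mem_support_iff _ _).1 ?_)
  exact (PMF.mem_support_map_iff _ _ _).2 ⟨j, (PMF.mem_support_iff _ _).2 hj, rfl⟩

end NPP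

/-! ### The four inequalities for a valid abstraction -/

namespace IsValidAbstraction

open AbsNode

variable {𝒱 : Type u} {rng : 𝒱 → Type v} {ι : Type w} {D : Type x} [CompleteLattice D]
  {P : NPP rng ι} {F : Set (Config rng)} {α : Set (Config rng) → D} {γ : D → Set (Config rng)}
  {G : StochasticGame (AbsNode P D)}

theorem resolve_mem_Vp (hG : IsValidAbstraction P F α γ G) {n : AbsNode P D} {s : D} {A : ι}
    {s' : D} {d : Fin (P.cmd A).m → D} (h : G.E n (resolve s A s' d)) :
    resolve s A s' d ∈ G.Vp := by
  rcases G.E_target h with (h | h) | h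
  · simpa using hG.V1_form _ h
  · simpa using hG.V2_form _ h
  · exact h

/-- Player 1 can propose a command that a non-final configuration enables. -/
theorem edge_propose (hG : IsValidAbstraction P F α γ G) {s : D} (hs : state s ∈ G.V1)
    {σ : Config rng} (hσ : σ ∈ γ s) (hF : σ ∉ F) {A : ι}
    (hA : Transition.Enables σ (P.cmd A).guard) : G.E (state s) (propose s A) := by
  rw [hG.state_propose_iff s A hs, (P.cmd A).isGuard.apply_eq]
  exact ⟨⟨σ, hσ, hA⟩, fun h => hF (h hσ)⟩

theorem edge_cross (hG : IsValidAbstraction P F α γ G) {s : D} {A : ι}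
    (h : propose s A ∈ G.V2) {σ : Config rng} (hσ : σ ∈ γ s)
    (hA : ¬ Transition.Enables σ (P.cmd A).guard) : G.E (propose s A) cross := by
  refine hG.propose_cross s A h fun h => hA ?_
  rw [(P.cmd A).isGuard.apply_eq] at h
  rw [← h] at hσ
  exact hσ.2

/-- Player 2 can accept a command in a way that is compatible with a given configuration. -/
theorem exists_accept (hG : IsValidAbstraction P F α γ G) {s : D} {A : ι}
    (h : propose s A ∈ G.V2) {σ : Config rng} (hσ : σ ∈ γ s)
    (hA : Transition.Enables σ (P.cmd A).guard) :
    ∃ s' d, G.E (propose s A) (resolve s A s' d) ∧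
      ∀ j, ((P.cmd A).isAssignment j).sem σ ∈ γ (d j) := by
  have hg : σ ∈ (P.cmd A).guard (γ s) := by
    rw [(P.cmd A).isGuard.apply_eq]
    exact ⟨hσ, hA⟩
  have := hG.propose_accept s A h hg
  simp only [Set.mem_iUnion, Set.mem_ofPred_eq, exists_prop] at this
  obtain ⟨s', ⟨d, hE⟩, hσ'⟩ := this
  refine ⟨s', d, hE, fun j => ?_⟩
  obtain ⟨_, _, _, _, h1, -, -, -, h2⟩ := hG.Vp_form _ (hG.resolve_mem_Vp hE)
  cases h1
  exact (h2 j).2 (((P.cmd A).isAssignment j).sem_mem hσ')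

theorem tsum_δ (hG : IsValidAbstraction P F α γ G) {s : D} {A : ι} {s' : D}
    {d : Fin (P.cmd A).m → D} (h : resolve s A s' d ∈ G.Vp) (W : AbsNode P D → ℝ≥0∞) :
    ∑' z, G.δ (resolve s A s' d) z * W z = ∑ j, (P.cmd A).p j * W (state (d j)) := by
  rw [hG.δ_eq s A s' d h, PMF.tsum_map_mul, tsum_fintype]

theorem finite_succ (hG : IsValidAbstraction P F α γ G) (q : AbsNode P D) :
    {z | G.E q z}.Finite :=
  hG.finite.subset fun _ h => G.E_target h

/-- One successor is good for all elements of `X` at once. -/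
theorem exists_le_iInf (hG : IsValidAbstraction P F α γ G) {q : AbsNode P D}
    (hq : ∃ z, G.E q z) {W : AbsNode P D → ℝ≥0∞} {X : Set (Config rng)} {f : Config rng → ℝ≥0∞}
    (h : ∀ σ ∈ X, ∃ z, G.E q z ∧ W z ≤ f σ) : ∃ z, G.E q z ∧ W z ≤ ⨅ σ ∈ X, f σ := by
  obtain ⟨z, hz, hmin⟩ := Set.exists_min_image {z | G.E q z} W (hG.finite_succ q) hq
  refine ⟨z, hz, le_iInf₂ fun σ hσ => ?_⟩
  obtain ⟨y, hy, hy'⟩ := h σ hσ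
  exact (hmin y hy).trans hy'

/-- The supremum over `X` need not be attained, but the maximum of `W` over the finitely many
successors is. -/
theorem exists_iSup_le (hG : IsValidAbstraction P F α γ G) {q : AbsNode P D}
    {W : AbsNode P D → ℝ≥0∞} {X : Set (Config rng)} {f : Config rng → ℝ≥0∞}
    (h : ∀ σ ∈ X, f σ = 0 ∨ ∃ z, G.E q z ∧ f σ ≤ W z) :
    (⨆ σ ∈ X, f σ) = 0 ∨ ∃ z, G.E q z ∧ (⨆ σ ∈ X, f σ) ≤ W z := by
  by_cases hq : ∃ z, G.E q z
  · obtain ⟨z, hz, hmax⟩ := Set.exists_max_image {z | G.E q z} W (hG.finite_succ q) hq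
    refine .inr ⟨z, hz, iSup₂_le fun σ hσ => ?_⟩
    obtain h | ⟨y, hy, hy'⟩ := h σ hσ
    · simp [h]
    · exact hy'.trans (hmax y hy)
  · left
    simp only [ENNReal.iSup_eq_zero]
    exact fun σ hσ => (h σ hσ).resolve_right fun ⟨z, hz, _⟩ => hq ⟨z, hz⟩

theorem mem_γ_start (hG : IsValidAbstraction P F α γ G) (hαγ : GaloisConnection α γ) :
    ∃ s, G.s0 = state s ∧ P.σ0 ∈ γ s :=
  ⟨_, hG.start_eq, hαγ.le_u_l _ rfl⟩

open Classical in
variable (F γ) in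
/-- Upper bounds on the probability of reaching `○` or `⊗` if both players minimize it. -/
noncomputable def weightMM : AbsNode P D → ℝ≥0∞
  | state s => ⨅ σ ∈ γ s ∩ P.reachable, ⨆ n, P.minVal F n σ
  | circle => 1
  | cross => 1
  | proposeEnd s => if (γ s ∩ F).Nonempty then 1 else ⊤
  | propose s A => ⨅ σ ∈ {σ ∈ γ s ∩ P.reachable | Transition.Enables σ (P.cmd A).guard},
      (P.cmd A).expect (fun σ => ⨆ n, P.minVal F n σ) σ
  | resolve _ A _ d => ∑ j, (P.cmd A).p j *
      ⨅ σ ∈ γ (d j) ∩ P.reachable, ⨆ n, P.minVal F n σ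

/-- For any reachable configuration of `γ s`, Player 1 can propose to end if it is final and
otherwise a command optimal for it in the limit; Player 2 has a compatible acceptance. -/
theorem reachMM_le [Finite ι] (hG : IsValidAbstraction P F α γ G) (hαγ : GaloisConnection α γ)
    (hP : P.NeverStuck F) : G.reachMM {circle, cross} ≤ P.minReach F := by
  have h₁ : ∃ φ : G.Strategy G.V1, φ.Lowers {circle, cross} (weightMM F γ) := by
    refine StochasticGame.exists_lowers Set.subset_union_left ?_
    intro q hq hqT hsucc
    obtain rfl | rfl | ⟨s, rfl⟩ := hG.V1_form q hq
    · simp at hqT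
    · simp at hqT
    refine hG.exists_le_iInf hsucc ?_
    rintro σ ⟨hσ, r, hr⟩
    by_cases hF : σ ∈ F
    · refine ⟨proposeEnd s, (hG.state_end_iff s hq).2 ⟨σ, hσ, hF⟩, ?_⟩
      rw [weightMM, if_pos ⟨σ, hσ, hF⟩]
      exact NPP.one_le_iSup_minVal hF
    · obtain ⟨A, hA, h⟩ := NPP.expect_iSup_minVal_le hF ((hP r σ hr).resolve_left hF)
      exact ⟨propose s A, hG.edge_propose hq hσ hF hA,
        (iInf₂_le σ ⟨⟨hσ, r, hr⟩, hA⟩).trans h⟩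
  have h₂ : ∃ φ : G.Strategy G.V2, φ.Lowers {circle, cross} (weightMM F γ) := by
    refine StochasticGame.exists_lowers Set.subset_union_right ?_
    intro q hq _ hsucc
    obtain ⟨s, rfl, hs⟩ | ⟨s, A, rfl, hs, -⟩ := hG.V2_form q hq
    · rw [weightMM]
      split_ifs with h
      · exact ⟨circle, hG.end_accept s hs h, le_rfl⟩
      -- Validity says nothing about the moves from `⟨s, ○⟩` if `γ s` has no final state. The weight
      -- `⊤` permits any of them, and Player 1 cannot move there.
      · obtain ⟨z, hz⟩ := hsucc
        exact ⟨z, hz, le_top⟩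
    · refine hG.exists_le_iInf hsucc ?_
      rintro σ ⟨⟨hσ, hr⟩, hA⟩
      obtain ⟨s', d, hE, hd⟩ := hG.exists_accept hq hσ hA
      refine ⟨_, hE, Finset.sum_le_sum fun j _ => ?_⟩
      by_cases hj : (P.cmd A).p j = 0
      · simp [hj]
      · exact mul_le_mul_right (iInf₂_le _ ⟨hd j, NPP.sem_mem_reachable hr hA hj⟩) _
  obtain ⟨φ₁, h₁⟩ := h₁
  obtain ⟨φ₂, h₂⟩ := h₂
  refine (iInf₂_le φ₁ φ₂).trans ((StochasticGame.reach_le ?_ h₁ h₂ ?_).trans ?_)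
  · rintro _ (rfl | rfl) <;> exact le_rfl
  · intro q hq _
    obtain ⟨s, A, s', d, rfl, -⟩ := hG.Vp_form q hq
    exact (hG.tsum_δ hq _).le
  · obtain ⟨s, hs, hσ⟩ := hG.mem_γ_start hαγ
    rw [hs, NPP.minReach_eq hP]
    exact iInf₂_le _ ⟨hσ, NPP.σ0_mem_reachable⟩

open Classical in
variable (F γ) in
/-- Upper bounds on the probability of reaching `○` if Player 2 minimizes it. -/
noncomputable def weightPM : AbsNode P D → ℝ≥0∞
  | state s => ⨅ σ ∈ γ s, ⨆ n, P.maxVal F n σ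
  | circle => 1
  | cross => 0
  | proposeEnd s => if (γ s ∩ F).Nonempty then if γ s ⊆ F then 1 else 0 else ⊤
  | propose s _ => ⨅ σ ∈ γ s, ⨆ n, P.maxVal F n σ
  | resolve _ A _ d => ∑ j, (P.cmd A).p j * ⨅ σ ∈ γ (d j), ⨆ n, P.maxVal F n σ

/-- Every move of Player 1 must be harmless, so a proposed command carries the weight of its state.
Player 2 then has a good answer for each configuration: `⊗`, worth 0, if it does not enable the
command, `○` if it is final, and a compatible acceptance otherwise. -/
theorem reachPM_le [Finite ι] (hG : IsValidAbstraction P F α γ G) (hαγ : GaloisConnection α γ) :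
    G.reachPM {circle} ≤ P.maxReach F := by
  refine iSup_le fun φ₁ => ?_
  have h₁ : φ₁.Lowers {circle} (weightPM F γ) := by
    refine φ₁.lowers Set.subset_union_left ?_
    intro q hq hqT z hz
    obtain rfl | rfl | ⟨s, rfl⟩ := hG.V1_form q hq
    · simp at hqT
    · exact absurd hz (hG.cross_dead z)
    obtain rfl | ⟨A, rfl⟩ := hG.state_succ s z hq hz
    · rw [weightPM.eq_4, if_pos ((hG.state_end_iff s hq).1 hz)]
      split_ifs with h
      · exact le_iInf₂ fun σ hσ => NPP.one_le_iSup_maxVal (h hσ)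
      · exact zero_le
    · exact le_rfl
  have h₂ : ∃ φ : G.Strategy G.V2, φ.Lowers {circle} (weightPM F γ) := by
    refine StochasticGame.exists_lowers Set.subset_union_right ?_
    intro q hq _ hsucc
    obtain ⟨s, rfl, hs⟩ | ⟨s, A, rfl, hs, -⟩ := hG.V2_form q hq
    · by_cases h : (γ s ∩ F).Nonempty
      · by_cases h' : γ s ⊆ F
        · refine ⟨circle, hG.end_accept s hs h, ?_⟩
          rw [weightPM, weightPM, if_pos h, if_pos h']
        -- Rejecting forever never reaches `○`, so weight 0 is preserved by the loop.
        · exact ⟨_, hG.end_reject s hs h h', le_rfl⟩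
      · obtain ⟨z, hz⟩ := hsucc
        refine ⟨z, hz, ?_⟩
        rw [weightPM.eq_4, if_neg h]
        exact le_top
    · refine hG.exists_le_iInf hsucc fun σ hσ => ?_
      by_cases hA : Transition.Enables σ (P.cmd A).guard
      · by_cases hF : σ ∈ F
        · exact ⟨circle, hG.propose_circle s A hq ⟨σ, hσ, hF⟩, NPP.one_le_iSup_maxVal hF⟩
        · obtain ⟨s', d, hE, hd⟩ := hG.exists_accept hq hσ hA
          refine ⟨_, hE, le_trans ?_ (NPP.expect_iSup_maxVal_le hF hA)⟩
          exact Finset.sum_le_sum fun j _ => mul_le_mul_right (iInf₂_le _ (hd j)) _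
      · exact ⟨cross, hG.edge_cross hq hσ hA, zero_le⟩
  obtain ⟨φ₂, h₂⟩ := h₂
  refine (iInf_le _ φ₂).trans ((StochasticGame.reach_le ?_ h₁ h₂ ?_).trans ?_)
  · rintro _ rfl
    exact le_rfl
  · intro q hq _
    obtain ⟨s, A, s', d, rfl, -⟩ := hG.Vp_form q hq
    exact (hG.tsum_δ hq _).le
  · obtain ⟨s, hs, hσ⟩ := hG.mem_γ_start hαγ
    rw [hs, NPP.maxReach_eq]
    exact iInf₂_le _ hσ

variable (F γ) in
/-- Lower bounds on the probability of reaching `○` within `m` steps if both players maximize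
it. -/
noncomputable def weightPP (m : ℕ) : AbsNode P D → ℝ≥0∞
  | state s => ⨆ σ ∈ γ s, P.maxVal F (m / 3) σ
  | circle => 1
  | cross => 0
  | proposeEnd s => Nat.casesOn ((m + 1) / 3) 0 fun _ => ⨆ σ ∈ γ s ∩ F, 1
  | propose s A => Nat.casesOn ((m + 1) / 3) 0 fun k =>
      ⨆ σ ∈ {σ ∈ γ s | Transition.Enables σ (P.cmd A).guard}, (P.cmd A).expect (P.maxVal F k) σ
  | resolve _ A _ d => Nat.casesOn ((m + 2) / 3) 0 fun k =>
      ∑ j, (P.cmd A).p j * ⨆ σ ∈ γ (d j), P.maxVal F k σ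

/-- Proposal, acceptance and random move make three game steps per command, whence the horizon `3 *
n` and the roundings in `weightPP`. -/
theorem le_reachPP [Finite ι] (hG : IsValidAbstraction P F α γ G) (hαγ : GaloisConnection α γ) :
    P.maxReach F ≤ G.reachPP {circle} := by
  rw [NPP.maxReach_eq]
  refine iSup_le fun n => ?_
  have h₁ : ∃ φ : G.Strategy G.V1, φ.Raises {circle} (3 * n) (weightPP F γ) := by
    refine StochasticGame.exists_raises Set.subset_union_left _ ?_
    intro m q hq hqT
    obtain rfl | rfl | ⟨s, rfl⟩ := hG.V1_form q hq
    · simp at hqT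
    · exact .inl rfl
    refine hG.exists_iSup_le fun σ hσ => ?_
    simp only [weightPP]
    cases hk : (m + 1) / 3 with
    | zero => exact .inl rfl
    | succ k =>
      by_cases hF : σ ∈ F
      · refine .inr ⟨proposeEnd s, (hG.state_end_iff s hq).2 ⟨σ, hσ, hF⟩, ?_⟩
        simp only
        exact le_iSup₂_of_le σ ⟨hσ, hF⟩ (NPP.maxVal_le_one_of_mem hF _)
      · refine (NPP.maxVal_succ_le hF k).imp_right ?_
        rintro ⟨A, hA, h⟩
        refine ⟨propose s A, hG.edge_propose hq hσ hF hA, ?_⟩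
        simp only
        exact h.trans (le_iSup₂_of_le σ ⟨hσ, hA⟩ le_rfl)
  have h₂ : ∃ φ : G.Strategy G.V2, φ.Raises {circle} (3 * n) (weightPP F γ) := by
    refine StochasticGame.exists_raises Set.subset_union_right _ ?_
    intro m q hq _
    obtain ⟨s, rfl, hs⟩ | ⟨s, A, rfl, hs, -⟩ := hG.V2_form q hq
    · rw [weightPP]
      cases (m + 1 + 1) / 3 with
      | zero => exact .inl rfl
      | succ k =>
        refine hG.exists_iSup_le fun σ hσ => .inr ⟨circle, hG.end_accept s hs ⟨σ, hσ⟩, le_rfl⟩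
    · rw [weightPP]
      cases hk : (m + 1 + 1) / 3 with
      | zero => exact .inl rfl
      | succ k =>
        refine hG.exists_iSup_le fun σ hσ => .inr ?_
        obtain ⟨s', d, hE, hd⟩ := hG.exists_accept hq hσ.1 hσ.2
        refine ⟨_, hE, ?_⟩
        rw [weightPP, show m + 2 = m + 1 + 1 from rfl, hk]
        exact Finset.sum_le_sum fun j _ => mul_le_mul_right (le_biSup (P.maxVal F k) (hd j)) _
  obtain ⟨φ₁, h₁⟩ := h₁
  obtain ⟨φ₂, h₂⟩ := h₂
  refine le_trans ?_ ((StochasticGame.le_reach ?_ ?_ h₁ h₂ ?_).trans (le_iSup₂_of_le φ₁ φ₂ le_rfl))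
  · obtain ⟨s, hs, hσ⟩ := hG.mem_γ_start hαγ
    rw [hs, weightPP, Nat.mul_div_cancel_left n three_pos]
    exact le_iSup₂_of_le _ hσ le_rfl
  · rintro m _ rfl
    exact le_rfl
  · rintro (s | _ | _ | s | ⟨s, A⟩ | ⟨s, A, s', d⟩) hq
    · simp [weightPP, NPP.maxVal]
    · simp at hq
    all_goals rfl
  · intro m q hq _
    obtain ⟨s, A, s', d, rfl, -⟩ := hG.Vp_form q hq
    rw [hG.tsum_δ hq]
    -- The command counter drops only at the random move that closes a round.
    simp only [weightPP, show (m + 1 + 2) / 3 = m / 3 + 1 by omega]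
    exact le_rfl

variable (F γ) in
/-- Lower bounds on the probability of reaching `○` or `⊗` within `m` steps if Player 2 maximizes
it. -/
noncomputable def weightMP (m : ℕ) : AbsNode P D → ℝ≥0∞
  | state s => ⨆ σ ∈ γ s ∩ P.reachable, P.minVal F (m / 3) σ
  | circle => 1
  | cross => 1
  | proposeEnd s => Nat.casesOn ((m + 1) / 3) 0 fun _ => ⨆ σ ∈ γ s ∩ F, 1
  | propose s _ => ⨆ σ ∈ γ s ∩ P.reachable, P.minVal F ((m + 1) / 3) σ
  | resolve _ A _ d => Nat.casesOn ((m + 2) / 3) 0 fun k =>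
      ∑ j, (P.cmd A).p j * ⨆ σ ∈ γ (d j) ∩ P.reachable, P.minVal F k σ

/-- Dual to `reachPM_le`: `⊗` now counts as reached, so a command that is not enabled by the
followed configuration gains Player 1 nothing. -/
theorem le_reachMP [Finite ι] (hG : IsValidAbstraction P F α γ G) (hαγ : GaloisConnection α γ)
    (hP : P.NeverStuck F) : P.minReach F ≤ G.reachMP {circle, cross} := by
  rw [NPP.minReach_eq hP]
  refine iSup_le fun n => le_iInf fun φ₁ => ?_
  have h₁ : φ₁.Raises {circle, cross} (3 * n) (weightMP F γ) := by
    refine φ₁.raises Set.subset_union_left _ ?_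
    intro m q _ _ hq hqT
    obtain rfl | rfl | ⟨s, rfl⟩ := hG.V1_form q hq
    · simp at hqT
    · simp at hqT
    constructor
    -- Player 1 must not profit from a dead end: a reachable configuration yields a move by
    -- `NeverStuck`, and without one the weight is an empty supremum.
    · by_cases hne : (γ s ∩ P.reachable).Nonempty
      · obtain ⟨σ, hσ, r, hr⟩ := hne
        right
        by_cases hF : σ ∈ F
        · exact ⟨_, (hG.state_end_iff s hq).2 ⟨σ, hσ, hF⟩⟩
        · obtain ⟨A, hA⟩ := (hP r σ hr).resolve_left hF
          exact ⟨_, hG.edge_propose hq hσ hF hA⟩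
      · left
        rw [weightMP, Set.not_nonempty_iff_eq_empty.1 hne]
        simp
    · intro z hz
      obtain rfl | ⟨A, rfl⟩ := hG.state_succ s z hq hz
      · rw [weightMP, weightMP]
        cases (m + 1) / 3 with
        | zero => simp [NPP.minVal]
        | succ k =>
          -- Proposing to end is never better for Player 1, since Player 2 can accept and obtain 1.
          obtain ⟨σ, hσ⟩ := (hG.state_end_iff s hq).1 hz
          exact iSup₂_le fun τ _ => le_iSup₂_of_le σ hσ (NPP.minVal_le_one _ τ)
      · exact le_rfl
  have h₂ : ∃ φ : G.Strategy G.V2, φ.Raises {circle, cross} (3 * n) (weightMP F γ) := by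
    refine StochasticGame.exists_raises Set.subset_union_right _ ?_
    intro m q hq _
    obtain ⟨s, rfl, hs⟩ | ⟨s, A, rfl, hs, -⟩ := hG.V2_form q hq
    · rw [weightMP]
      cases (m + 1 + 1) / 3 with
      | zero => exact .inl rfl
      | succ k =>
        refine hG.exists_iSup_le fun σ hσ => .inr ⟨circle, hG.end_accept s hs ⟨σ, hσ⟩, le_rfl⟩
    · rw [weightMP]
      cases hk : (m + 1 + 1) / 3 with
      | zero => simp [NPP.minVal]
      | succ k =>
        refine hG.exists_iSup_le fun σ ⟨hσ, hr⟩ => .inr ?_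
        by_cases hF : σ ∈ F
        · exact ⟨circle, hG.propose_circle s A hq ⟨σ, hσ, hF⟩, NPP.minVal_le_one _ σ⟩
        by_cases hA : Transition.Enables σ (P.cmd A).guard
        · obtain ⟨s', d, hE, hd⟩ := hG.exists_accept hq hσ hA
          refine ⟨_, hE, (NPP.minVal_succ_le hF hA k).trans ?_⟩
          rw [weightMP, show m + 2 = m + 1 + 1 from rfl, hk]
          refine Finset.sum_le_sum fun j _ => ?_
          by_cases hj : (P.cmd A).p j = 0
          · simp [hj]
          · exact mul_le_mul_right
              (le_biSup (P.minVal F k) (Set.mem_inter (hd j) (NPP.sem_mem_reachable hr hA hj))) _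
        · exact ⟨cross, hG.edge_cross hq hσ hA, NPP.minVal_le_one _ σ⟩
  obtain ⟨φ₂, h₂⟩ := h₂
  refine le_trans ?_ ((StochasticGame.le_reach ?_ ?_ h₁ h₂ ?_).trans (le_iSup_of_le φ₂ le_rfl))
  · obtain ⟨s, hs, hσ⟩ := hG.mem_γ_start hαγ
    rw [hs, weightMP, Nat.mul_div_cancel_left n three_pos]
    exact le_iSup₂_of_le _ ⟨hσ, NPP.σ0_mem_reachable⟩ le_rfl
  · rintro m _ (rfl | rfl) <;> exact le_rfl
  · rintro (s | _ | _ | s | ⟨s, A⟩ | ⟨s, A, s', d⟩) hq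
    · simp [weightMP, NPP.minVal]
    · simp at hq
    · simp at hq
    · rfl
    · simp [weightMP, NPP.minVal]
    · rfl
  · intro m q hq _
    obtain ⟨s, A, s', d, rfl, -⟩ := hG.Vp_form q hq
    rw [hG.tsum_δ hq]
    simp only [weightMP, show (m + 1 + 2) / 3 = m / 3 + 1 by omega]
    exact le_rfl

end IsValidAbstraction

theorem theorem1 {𝒱 : Type u} [Finite 𝒱] {rng : 𝒱 → Type v} {ι : Type w} [Finite ι]
    {D : Type x} [CompleteLattice D]
    (α : Set (Config rng) → D) (γ : D → Set (Config rng)) (hαγ : GaloisConnection α γ)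
    (P : NPP rng ι) (F : Set (Config rng)) (hσ0 : P.σ0 ∉ F) (hstuck : P.NeverStuck F)
    (G : StochasticGame (AbsNode P D)) (hG : IsValidAbstraction P F α γ G) :
    P.minReach F ∈ Set.Icc (G.reachMM {AbsNode.circle, AbsNode.cross})
      (G.reachMP {AbsNode.circle, AbsNode.cross}) ∧
    P.maxReach F ∈ Set.Icc (G.reachPM {AbsNode.circle}) (G.reachPP {AbsNode.circle}) := by
  exact ⟨⟨hG.reachMM_le hαγ hstuck, hG.le_reachMP hαγ hstuck⟩, hG.reachPM_le hαγ, hG.le_reachPP hαγ⟩
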